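/- Strings are finite binary strings, $|x|$ is the length of $x$, and $\log$ is the binary logarithm. Fix a universal reference machine $U$ (a partial computable function of a program and a conditional string that simulates every other such function at the cost of a constant number of additional program bits). The plain conditional Kolmogorov complexity $C(z\mid y)$ is the length of a shortest program $p$ with $U(p,y)=z$, and $C(z)=C(z\mid\epsilon)$. Fix a computable bijection $\phi$ from the finite sets of strings onto the strings. For a finite set $A$ of strings put $C(A\mid y)=C(\phi(A)\mid y)$ and $C(A)=C(\phi(A))$, and for a finite family $\mathcal F$ of finite sets of strings put $C(\mathcal F)=C(\{\phi(A):A\in\mathcal F\})$. A distortion family is a set $\mathcal A$ of finite nonempty sets of strings; $\mathcal A_n=\{A\in\mathcal A: A\subseteq\{0,1\}^n\}$. Let $\mathcal A$ be a distortion family such that (Property 2) for every $A\in\mathcal A$, all elements of $A$ have the same length; (Property 3) $C(\mathcal A_n)=O(\log n)$, that is, $C(\mathcal A_n)\le c'\log n+c'$ for all $n$, with a constant $c'$. Then there is a constant $c$ such that for every natural number $n$, every string $x$ of length $n$ and every $B\in\mathcal A$ with $x\in B$ there is an $A\in\mathcal A$ with $x\in A$, $\lceil\log|A|\rceil=\lceil\log|B|\rceil$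 and $$C(A)\le I(x:B)+c\,(\log C(B)+\log n)+c,$$ where $I(x:B)=C(B)-C(B\mid x)$ is the algorithmic information in $x$ about $B$. (The terms $\log 0$ that occur for $n=0$ or $C(B)=0$ are read as $0$.) -/

import Mathlib

/-! ### Binary strings and finite sets of strings as finite objects -/

/-- The number of a binary string in the ordering `(0, ε), (1, 0), (2, 1), (3, 00), (4, 01), …`. -/
def strToNat (x : List Bool) : ℕ :=
  x.foldl (fun m b => 2 * m + (if b then 2 else 1)) 0

/-- The string with a given number in that ordering. -/
def natToStr : ℕ → List Bool
  | 0 => []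
  | m + 1 => natToStr (m / 2) ++ [decide (m % 2 = 1)]
decreasing_by omega

theorem strToNat_append (x : List Bool) (b : Bool) :
    strToNat (x ++ [b]) = 2 * strToNat x + (if b then 2 else 1) := by
  simp [strToNat]

theorem strToNat_natToStr (m : ℕ) : strToNat (natToStr m) = m := by
  induction m using Nat.strong_induction_on with
  | _ m ih =>
    cases m with
    | zero => simp [natToStr, strToNat]
    | succ m =>
      rw [natToStr, strToNat_append, ih (m / 2) (by omega)]
      rcases Nat.mod_two_eq_zero_or_one m with h | h <;> simp [h] <;> omega

theorem natToStr_strToNat (x : List Bool) : natToStr (strToNat x) = x := by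
  induction x using List.reverseRecOn with
  | nil => simp [strToNat, natToStr]
  | append_singleton x b ih =>
    rw [strToNat_append]
    cases b
    · rw [show 2 * strToNat x + (if false = true then 2 else 1) = 2 * strToNat x + 1 by simp,
        natToStr, show 2 * strToNat x / 2 = strToNat x by omega, ih]
      simp
    · rw [show 2 * strToNat x + (if true = true then 2 else 1) = (2 * strToNat x + 1) + 1 by simp,
        natToStr, show (2 * strToNat x + 1) / 2 = strToNat x by omega, ih]
      simp [Nat.add_mod]

/-- The identification of binary strings with natural numbers. -/
def strEquivNat : List Bool ≃ ℕ where
  toFun := strToNat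
  invFun := natToStr
  left_inv := natToStr_strToNat
  right_inv := strToNat_natToStr

/-- A computable bijection from finite sets of strings onto strings: strings are identified
with natural numbers, and the finite set `{n₁, …, n_k}` of natural numbers is coded by
`2 ^ n₁ + ⋯ + 2 ^ n_k`. -/
def setCode : Finset (List Bool) ≃ List Bool :=
  strEquivNat.finsetCongr.trans (Finset.equivBitIndices.symm.trans strEquivNat.symm)

/-! ### Plain Kolmogorov complexity -/

/-- `U` is a reference machine: a partial computable function of a program and of a
conditional string that simulates every other such function at the cost of at most
a constant number (depending on the simulated function) of additional program bits. -/
def IsReferenceMachine (U : List Bool → List Bool →. List Bool) : Prop :=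
  Partrec₂ U ∧
    ∀ V : List Bool → List Bool →. List Bool, Partrec₂ V →
      ∃ c : ℕ, ∀ p y z : List Bool, z ∈ V p y →
        ∃ q : List Bool, q.length ≤ p.length + c ∧ z ∈ U q y

/-- Reference machines exist. -/
theorem exists_isReferenceMachine :
    ∃ U : List Bool → List Bool →. List Bool, IsReferenceMachine U := by
  let F : List Bool → List Bool → Part (List Bool) := fun q y =>
    ((Nat.Partrec.Code.eval (Denumerable.ofNat Nat.Partrec.Code (q.idxOf false))
      (Encodable.encode (q.drop (q.idxOf false + 1), y))).bind
        fun m => ((Encodable.decode m : Option (List Bool)) : Part (List Bool)))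
  refine ⟨F, ?_, ?_⟩
  · have hi : Computable fun a : List Bool × List Bool => a.1.idxOf false :=
      (Primrec.list_idxOf.comp (Primrec.const false) Primrec.fst).to_comp
    have hd : Computable fun a : List Bool × List Bool => a.1.drop (a.1.idxOf false + 1) :=
      Primrec.list_drop.to_comp.comp (Computable.succ.comp hi) Computable.fst
    have h1 : Partrec fun a : List Bool × List Bool =>
        Nat.Partrec.Code.eval (Denumerable.ofNat Nat.Partrec.Code (a.1.idxOf false))
          (Encodable.encode (a.1.drop (a.1.idxOf false + 1), a.2)) :=
      Nat.Partrec.Code.eval_part.comp ((Computable.ofNat _).comp hi)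
        (Computable.encode.comp (hd.pair Computable.snd))
    exact h1.bind ((Computable.ofOption (Computable.decode.comp Computable.snd)))
  · intro V hV
    obtain ⟨c, hc⟩ := Nat.Partrec.Code.exists_code.1 hV
    refine ⟨Encodable.encode c + 1, fun p y z hz =>
      ⟨List.replicate (Encodable.encode c) true ++ false :: p, by simp; omega, ?_⟩⟩
    have hidx : (List.replicate (Encodable.encode c) true ++ false :: p).idxOf false
        = Encodable.encode c := by
      rw [List.idxOf_append_of_notMem (by simp [List.mem_replicate])]
      simp
    have hdrop : (List.replicate (Encodable.encode c) true ++ false :: p).drop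
        (Encodable.encode c + 1) = p := by
      rw [← List.drop_drop]
      simp
    simp only [F, hidx, hdrop, Denumerable.ofNat_encode, hc, Encodable.encodek,
      Part.coe_some, Part.bind_some]
    refine Part.mem_bind_iff.2 ⟨Encodable.encode z, (Part.mem_map_iff _).2 ⟨z, hz, rfl⟩, ?_⟩
    simp

/-- Conditional Kolmogorov complexity `C(z | y)` of a string: the least length of a program
that prints `z` and halts when it is given `y`. -/
noncomputable def condC (U : List Bool → List Bool →. List Bool) (z y : List Bool) : ℕ :=
  sInf {l : ℕ | ∃ p : List Bool, p.length = l ∧ z ∈ U p y}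

/-- Conditional Kolmogorov complexity `C(A | y)` of a finite set of strings, given a string. -/
noncomputable def condCSet (U : List Bool → List Bool →. List Bool)
    (A : Finset (List Bool)) (y : List Bool) : ℕ :=
  condC U (setCode A) y

/-- Kolmogorov complexity `C(A) = C(A | ε)` of a finite set of strings. -/
noncomputable def CSet (U : List Bool → List Bool →. List Bool) (A : Finset (List Bool)) : ℕ :=
  condCSet U A []

/-- Kolmogorov complexity of a finite family of finite sets of strings: the complexity of the
set of codes of its members. -/
noncomputable def CFamily (U : List Bool → List Bool →. List Bool)
    (F : Finset (Finset (List Bool))) : ℕ :=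
  CSet U (F.image setCode)

/-- The algorithmic information `I(x : B) = C(B) - C(B | x)` in the string `x` about the
finite set `B`. It is an integer. -/
noncomputable def algInfo (U : List Bool → List Bool →. List Bool)
    (x : List Bool) (B : Finset (List Bool)) : ℤ :=
  (CSet U B : ℤ) - (condCSet U B x : ℤ)

/-! ### Distortion families -/

/-- A distortion family is a set of finite nonempty sets of strings. -/
def IsDistortionFamily (𝒜 : Set (Finset (List Bool))) : Prop :=
  ∀ A ∈ 𝒜, A.Nonempty

/-- The set `{0,1}ⁿ` of all strings of length `n`. -/
def wordsOfLength (n : ℕ) : Finset (List Bool) :=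
  (Finset.univ : Finset (Fin n → Bool)).image List.ofFn

theorem mem_wordsOfLength (n : ℕ) (x : List Bool) : x ∈ wordsOfLength n ↔ x.length = n := by
  simp only [wordsOfLength, Finset.mem_image, Finset.mem_univ, true_and]
  constructor
  · rintro ⟨f, rfl⟩
    simp
  · rintro rfl
    exact ⟨x.get, List.ofFn_get x⟩

open Classical in
/-- `𝒜ₙ`, the members of `𝒜` that are contained in `{0,1}ⁿ`. -/
noncomputable def familyAt (𝒜 : Set (Finset (List Bool))) (n : ℕ) :
    Finset (Finset (List Bool)) :=
  (wordsOfLength n).powerset.filter (fun A => A ∈ 𝒜)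

/-- Property 2: in every member of the family all strings have the same length. -/
def Property2 (𝒜 : Set (Finset (List Bool))) : Prop :=
  ∀ A ∈ 𝒜, ∀ x ∈ A, ∀ y ∈ A, x.length = y.length

/-- Property 3: `C(𝒜ₙ) = O(log n)`, that is, `C(𝒜ₙ) ≤ c * log n + c` for some constant `c`.
(For `n = 0` the term `log n` is read as `0`.) -/
def Property3 (U : List Bool → List Bool →. List Bool) (𝒜 : Set (Finset (List Bool))) : Prop :=
  ∃ c : ℝ, ∀ n : ℕ, (CFamily U (familyAt 𝒜 n) : ℝ) ≤ c * Real.logb 2 (n : ℝ) + c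

/-! Put `n = |x|`, `m = C(B)`, `l = ⌈log |B|⌉`. Given `𝒜ₙ` (at a cost that Property 3 makes
logarithmic), run all programs of length about `m` and let the members of `𝒜ₙ` of log-size `l`
arrive one by one, at most `2 ^ (m + 1)` arrivals in all. Let `j` be the number of arrivals
containing `x` before `B` arrives. Given `x`, the set `B` is determined by `j` and the parameters,
so `C(B | x) ≤ log j + O(log)`: if `C(B | x)` is large, `x` lies in many arriving sets.

It remains to select online a few of the arriving sets so that every string lying in many of them is
covered. This is done by multiplicative weights: membership in an arriving unselected set multiplies
the weight of an uncovered point by `1 + 1/M`, and a set is selected once its uncovered weight is at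
least the number `D` of points. A potential argument (`sum_weight_le`) bounds the number of
selections by about `2 ^ (m + 1) / M`, while a point with about `M * log D` hits is heavy enough to
force a selection by itself (`exists_isSelected`).

With `M = 2 ^ r ≈ j / (n + 1)` some selected `A` contains `x`. Its index among the selected sets has
about `m - r` bits, and `r` is `log j` up to `O(log n)`, so `C(A) ≤ C(B) - C(B | x) + O(log)`. The
two descriptions are `condC_le_of_arrival_hits` and `condC_le_of_isSelected`; both rest on
`condC_le_of_enumerated`. -/

/-! ### Primitive recursive building blocks -/

section Primrec

variable {α : Type*} [Primcodable α]

theorem primrec_nat_pow : Primrec₂ ((· ^ ·) : ℕ → ℕ → ℕ) :=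
  Primrec₂.unpaired'.1 Nat.Primrec.pow

theorem primrec_nat_testBit : Primrec₂ Nat.testBit := by
  have h : PrimrecPred fun p : ℕ × ℕ => p.1 / 2 ^ p.2 % 2 = 1 :=
    PrimrecRel.comp Primrec.eq
      (Primrec.nat_mod.comp (Primrec.nat_div.comp Primrec.fst
        (primrec_nat_pow.comp (Primrec.const 2) Primrec.snd)) (Primrec.const 2))
      (Primrec.const 1)
  exact (PrimrecPred.decide h).of_eq fun p => (Nat.testBit_eq_decide_div_mod_eq).symm

theorem primrec_strToNat : Primrec strToNat := by
  refine Primrec.list_foldl (f := fun x : List Bool => x) (g := fun _ => 0)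
    (h := fun _ (q : ℕ × Bool) => 2 * q.1 + (if q.2 then 2 else 1))
    Primrec.id (Primrec.const 0) ?_
  refine Primrec.nat_add.comp (Primrec.nat_mul.comp (Primrec.const 2)
    (Primrec.fst.comp Primrec.snd)) ?_
  exact Primrec.ite (PrimrecRel.comp Primrec.eq (Primrec.snd.comp Primrec.snd) (Primrec.const true))
    (Primrec.const 2) (Primrec.const 1)

theorem primrec_sum_range {f : α → ℕ → ℕ} (hf : Primrec₂ f) :
    Primrec₂ fun a s => ∑ i ∈ Finset.range s, f a i := by
  have h : Primrec₂ fun a s => Nat.rec (motive := fun _ => ℕ) 0 (fun i r => r + f a i) s :=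
    Primrec.nat_rec (Primrec.const 0)
      (Primrec.nat_add.comp (Primrec.snd.comp Primrec.snd)
        (hf.comp Primrec.fst (Primrec.fst.comp Primrec.snd))).to₂
  refine h.of_eq fun a s => ?_
  induction s with
  | zero => simp
  | succ s ih => rw [Finset.sum_range_succ, ← ih]

theorem primrec_nat_count {b : α → ℕ → Bool} (hb : Primrec₂ b) :
    Primrec₂ fun a s => Nat.count (fun t => b a t = true) s := by
  have hf : Primrec₂ fun a t => if b a t = true then 1 else 0 :=
    Primrec.ite (PrimrecRel.comp Primrec.eq hb (Primrec.const true))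
      (Primrec.const 1) (Primrec.const 0)
  refine (primrec_sum_range hf).of_eq fun a s => ?_
  rw [Nat.count_eq_card_filter_range, Finset.card_filter]

end Primrec

/-! ### The numbering of strings -/

theorem two_pow_length_le (x : List Bool) : 2 ^ x.length ≤ strToNat x + 1 := by
  induction x using List.reverseRecOn with
  | nil => simp [strToNat]
  | append_singleton x b ih =>
    rw [strToNat_append, List.length_append, List.length_singleton, pow_succ]
    split <;> omega

theorem strToNat_lt (x : List Bool) : strToNat x + 1 < 2 ^ (x.length + 1) := by
  induction x using List.reverseRecOn with
  | nil => simp [strToNat]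
  | append_singleton x b ih =>
    rw [strToNat_append, List.length_append, List.length_singleton, pow_succ]
    split <;> omega

theorem strToNat_injective : Function.Injective strToNat := strEquivNat.injective

theorem testBit_setCode (A : Finset (List Bool)) (x : List Bool) :
    (strToNat (setCode A)).testBit (strToNat x) = true ↔ x ∈ A := by
  have h1 : strToNat (setCode A) = ∑ i ∈ strEquivNat.finsetCongr A, 2 ^ i := by
    change strEquivNat (strEquivNat.symm _) = _
    rw [Equiv.apply_symm_apply]
    rfl
  rw [h1, ← Nat.mem_bitIndices, ← List.mem_toFinset, Finset.toFinset_bitIndices_sum_two_pow,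
    Equiv.finsetCongr_apply, Finset.mem_map_equiv]
  change strEquivNat.symm (strEquivNat x) ∈ A ↔ _
  rw [Equiv.symm_apply_apply]

/-- Lets the size of a set be computed from its code, so that the condition on `⌈log |A|⌉` can be
tested during the enumeration. -/
theorem count_testBit_setCode (A : Finset (List Bool)) (D : ℕ) (hA : ∀ x ∈ A, strToNat x < D) :
    Nat.count (fun i => (strToNat (setCode A)).testBit i = true) D = A.card := by
  rw [Nat.count_eq_card_filter_range, ← Finset.card_map strEquivNat.toEmbedding]
  congr 1
  ext i
  obtain ⟨x, rfl⟩ := strEquivNat.surjective i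
  simp only [Finset.mem_filter, Finset.mem_range, Finset.mem_map_equiv, Equiv.symm_apply_apply]
  change strToNat x < D ∧ (strToNat (setCode A)).testBit (strToNat x) = true ↔ _
  rw [testBit_setCode]
  exact ⟨fun h => h.2, fun h => ⟨hA x h, h⟩⟩

/-! ### Pairs of strings -/

/-- A self-delimiting code of the string `u`, followed by `w`. -/
def joinStr (u w : List Bool) : List Bool :=
  List.replicate u.length true ++ false :: (u ++ w)

/-- The first component of a pair coded by `joinStr`. -/
def splitFst (p : List Bool) : List Bool :=
  (p.drop (p.idxOf false + 1)).take (p.idxOf false)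

/-- The second component of a pair coded by `joinStr`. -/
def splitSnd (p : List Bool) : List Bool :=
  (p.drop (p.idxOf false + 1)).drop (p.idxOf false)

theorem idxOf_joinStr (u w : List Bool) : (joinStr u w).idxOf false = u.length := by
  rw [joinStr, List.idxOf_append_of_notMem (by simp [List.mem_replicate])]
  simp

theorem drop_joinStr (u w : List Bool) : (joinStr u w).drop (u.length + 1) = u ++ w := by
  rw [joinStr, ← List.drop_drop]
  simp

theorem splitFst_joinStr (u w : List Bool) : splitFst (joinStr u w) = u := by
  rw [splitFst, idxOf_joinStr, drop_joinStr, List.take_left]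

theorem splitSnd_joinStr (u w : List Bool) : splitSnd (joinStr u w) = w := by
  rw [splitSnd, idxOf_joinStr, drop_joinStr, List.drop_left]

theorem length_joinStr (u w : List Bool) :
    (joinStr u w).length = 2 * u.length + 1 + w.length := by
  simp [joinStr]
  omega

theorem primrec_idxOf_false : Primrec fun p : List Bool => p.idxOf false :=
  Primrec.list_idxOf.comp (Primrec.const false) Primrec.id

theorem primrec_splitFst : Primrec splitFst :=
  Primrec.list_take.comp primrec_idxOf_false
    (Primrec.list_drop.comp (Primrec.succ.comp primrec_idxOf_false) Primrec.id)

theorem primrec_splitSnd : Primrec splitSnd :=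
  Primrec.list_drop.comp primrec_idxOf_false
    (Primrec.list_drop.comp (Primrec.succ.comp primrec_idxOf_false) Primrec.id)

/-! ### Upper bounds for complexity -/

section Complexity

variable {U : List Bool → List Bool →. List Bool}

theorem condC_le {p z y : List Bool} (h : z ∈ U p y) : condC U z y ≤ p.length :=
  Nat.sInf_le ⟨p, rfl, h⟩

theorem IsReferenceMachine.exists_program (hU : IsReferenceMachine U) (z y : List Bool) :
    ∃ p : List Bool, p.length = condC U z y ∧ z ∈ U p y := by
  obtain ⟨c, hc⟩ := hU.2 (fun p _ => Part.some p) (Computable.fst.partrec)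
  obtain ⟨q, -, hq⟩ := hc z y z (Part.mem_some z)
  exact Nat.sInf_mem (s := {l : ℕ | ∃ p : List Bool, p.length = l ∧ z ∈ U p y}) ⟨_, q, rfl, hq⟩

theorem mem_rfindOpt_of_unique {β : Type*} {h : ℕ → Option β} {s : ℕ} {z : β}
    (hs : h s = some z) (hu : ∀ t, (h t).isSome → t = s) : z ∈ Nat.rfindOpt h := by
  have hd : (Nat.rfindOpt h).Dom := Nat.rfindOpt_dom.2 ⟨s, z, hs⟩
  obtain ⟨t, ht⟩ := Nat.rfindOpt_spec (Part.get_mem hd)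
  have hts : t = s := hu t (by rw [Option.mem_def.1 ht]; rfl)
  subst hts
  have : z = (Nat.rfindOpt h).get hd := by
    rw [Option.mem_def, hs] at ht
    exact Option.some.inj ht
  rw [this]
  exact Part.get_mem hd

/-- An object that is enumerated, by a process with parameters `a` and `F` (the latter the output
of the program `v`) and conditional string `y`, is described by the parameters and by the number
of objects enumerated before it. -/
theorem condC_le_of_enumerated (hU : IsReferenceMachine U)
    {f : ℕ × List Bool × List Bool → ℕ → Option (List Bool)} (hf : Primrec₂ f) :
    ∃ c : ℕ, ∀ (a : ℕ) (v F y z : List Bool) (s : ℕ), F ∈ U v [] → f (a, F, y) s = some z →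
      condC U z y ≤
        (natToStr (Nat.count (fun t => (f (a, F, y) t).isSome = true) s)).length +
          2 * (natToStr a).length + 2 * v.length + c := by
  -- The program codes `a`, then `v`, then the index. The count of outputs strictly before `s` grows
  -- at every output, so index and output together single out one time.
  let h : (List Bool × List Bool) × List Bool → ℕ → Option (List Bool) := fun w s =>
    if Nat.count (fun t => (f (strToNat (splitFst w.1.1), w.2, w.1.2) t).isSome = true) s
        = strToNat (splitSnd (splitSnd w.1.1)) then
      f (strToNat (splitFst w.1.1), w.2, w.1.2) s
    else none
  let V : List Bool → List Bool →. List Bool := fun p y =>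
    (U (splitFst (splitSnd p)) []).bind fun F => Nat.rfindOpt (h ((p, y), F))
  have hpar : Primrec fun w : (List Bool × List Bool) × List Bool =>
      (strToNat (splitFst w.1.1), w.2, w.1.2) :=
    Primrec.pair (primrec_strToNat.comp (primrec_splitFst.comp (Primrec.fst.comp Primrec.fst)))
      (Primrec.pair Primrec.snd (Primrec.snd.comp Primrec.fst))
  have hh : Primrec₂ h := by
    refine Primrec.ite (PrimrecRel.comp Primrec.eq ?_ ?_) ?_ (Primrec.const none)
    · exact (primrec_nat_count (Primrec.option_isSome.comp₂ hf)).comp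
        (hpar.comp Primrec.fst) Primrec.snd
    · exact primrec_strToNat.comp (primrec_splitSnd.comp (primrec_splitSnd.comp
        (Primrec.fst.comp (Primrec.fst.comp Primrec.fst))))
    · exact hf.comp (hpar.comp Primrec.fst) Primrec.snd
  have hV : Partrec₂ V := by
    have h1 : Partrec fun w : List Bool × List Bool => U (splitFst (splitSnd w.1)) [] :=
      hU.1.comp ((primrec_splitFst.comp (primrec_splitSnd.comp Primrec.fst)).to_comp)
        (Computable.const [])
    exact h1.bind (Partrec.rfindOpt (Primrec₂.to_comp hh))
  obtain ⟨c, hc⟩ := hU.2 V hV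
  -- The 2 pays for the separators of the two nested pairs.
  refine ⟨c + 2, fun a v F y z s hF hs => ?_⟩
  set i := Nat.count (fun t => (f (a, F, y) t).isSome = true) s with hi
  have hz : z ∈ V (joinStr (natToStr a) (joinStr v (natToStr i))) y := by
    refine Part.mem_bind_iff.2 ⟨F, ?_, ?_⟩
    · rwa [splitSnd_joinStr, splitFst_joinStr]
    · have hsome : (f (a, F, y) s).isSome = true := by rw [hs]; rfl
      refine mem_rfindOpt_of_unique (s := s) ?_ fun t ht => ?_
      · simp only [h, splitSnd_joinStr, splitFst_joinStr, strToNat_natToStr]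
        rw [if_pos hi.symm, hs]
      · simp only [h, splitSnd_joinStr, splitFst_joinStr, strToNat_natToStr] at ht
        split_ifs at ht with hti
        · exact Nat.count_injective ht hsome hti
        · simp at ht
  obtain ⟨q, hq, hqz⟩ := hc _ y z hz
  have := condC_le hqz
  rw [length_joinStr, length_joinStr] at hq
  omega

end Complexity

/-! ### Online covering

Sets of numbers below `D`, coded by the bits of numbers `g 0, g 1, …`, arrive one by one, and some
of them are selected. A number that is not yet covered by a selected set has weight
`(1 + 1 / M) ^ h`, where `h` is the number of sets so far that contain it, and a set is selected
when the weights of its uncovered elements sum up to at least `D`. -/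

/-- The number of `t < s` such that bit `x` of `g t` is set. -/
def hits (g : ℕ → ℕ) (s x : ℕ) : ℕ := Nat.count (fun t => (g t).testBit x = true) s

/-- The number `x` belongs to one of the sets coded by the members of `L`. -/
def Covered (L : List ℕ) (x : ℕ) : Prop := ∃ a ∈ L, a.testBit x = true

instance (L : List ℕ) (x : ℕ) : Decidable (Covered L x) :=
  inferInstanceAs (Decidable (∃ a ∈ L, a.testBit x = true))

/-- The weight of the uncovered elements of the set `g s`, multiplied by `M ^ s`. -/
def scaledWeight (g : ℕ → ℕ) (D M s : ℕ) (L : List ℕ) : ℕ :=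
  ∑ x ∈ Finset.range D,
    if (g s).testBit x = true ∧ ¬ Covered L x then
      (M + 1) ^ hits g s x * M ^ (s - hits g s x)
    else 0

/-- The list of the sets that are selected before time `s`. -/
def selected (g : ℕ → ℕ) (D M : ℕ) : ℕ → List ℕ
  | 0 => []
  | s + 1 =>
    if D * M ^ s ≤ scaledWeight g D M s (selected g D M s) then
      g s :: selected g D M s
    else selected g D M s

/-- The set that arrives at time `s` is selected. -/
def isSelected (g : ℕ → ℕ) (D M s : ℕ) : Bool :=
  decide (D * M ^ s ≤ scaledWeight g D M s (selected g D M s))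

section Covering

variable {g : ℕ → ℕ} {D M : ℕ}

theorem selected_succ (s : ℕ) :
    selected g D M (s + 1) =
      if isSelected g D M s = true then g s :: selected g D M s else selected g D M s := by
  simp [selected, isSelected]

theorem hits_le (s x : ℕ) : hits g s x ≤ s := Nat.count_le _

theorem hits_succ (s x : ℕ) :
    hits g (s + 1) x = hits g s x + if (g s).testBit x = true then 1 else 0 :=
  Nat.count_succ _ _

theorem length_selected (s : ℕ) :
    (selected g D M s).length = Nat.count (fun t => isSelected g D M t = true) s := by
  induction s with
  | zero => simp [selected]
  | succ s ih =>
    rw [selected_succ, Nat.count_succ]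
    split <;> simp [ih]

theorem exists_of_mem_selected {s a : ℕ} (h : a ∈ selected g D M s) :
    ∃ t < s, g t = a ∧ isSelected g D M t = true := by
  induction s with
  | zero => simp [selected] at h
  | succ s ih =>
    rw [selected_succ] at h
    split at h
    · rcases List.mem_cons.1 h with rfl | h
      · exact ⟨s, by omega, rfl, by assumption⟩
      · obtain ⟨t, ht, h⟩ := ih h
        exact ⟨t, by omega, h⟩
    · obtain ⟨t, ht, h⟩ := ih h
      exact ⟨t, by omega, h⟩

/-- The threshold is positive, so a time at which no set arrives (coded by `0`) is never selected.
-/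
theorem ne_zero_of_isSelected (hD : 0 < D) (hM : 0 < M) {s : ℕ}
    (h : isSelected g D M s = true) : g s ≠ 0 := by
  intro h0
  have h1 := of_decide_eq_true h
  have h2 : scaledWeight g D M s (selected g D M s) = 0 := by
    simp [scaledWeight, h0]
  rw [h2] at h1
  have : 0 < D * M ^ s := by positivity
  omega

/-- The weight of an uncovered number at time `s`, and `0` for a covered one. -/
noncomputable def weight (g : ℕ → ℕ) (D M s x : ℕ) : ℝ :=
  if Covered (selected g D M s) x then 0 else (1 + 1 / (M : ℝ)) ^ hits g s x

theorem weight_nonneg (s x : ℕ) : 0 ≤ weight g D M s x := by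
  unfold weight
  split <;> positivity

/-- Since `(1 + 1/M) ^ h * M ^ s = (M + 1) ^ h * M ^ (s - h)`, the selection rule is decided in `ℕ`,
hence primitive recursively, while the potential argument runs in `ℝ`. -/
theorem scaledWeight_eq (hM : 0 < M) (s : ℕ) :
    (scaledWeight g D M s (selected g D M s) : ℝ) =
      (∑ x ∈ Finset.range D, if (g s).testBit x = true then weight g D M s x else 0) *
        (M : ℝ) ^ s := by
  have hM' : (M : ℝ) ≠ 0 := by positivity
  rw [scaledWeight, Nat.cast_sum, Finset.sum_mul]
  refine Finset.sum_congr rfl fun x _ => ?_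
  unfold weight
  by_cases h1 : (g s).testBit x = true <;> by_cases h2 : Covered (selected g D M s) x <;>
    simp only [h1, h2, if_true, if_false, not_true, not_false_eq_true, and_self, and_false, false_and,
      Nat.cast_zero, zero_mul, Bool.false_eq_true]
  push_cast
  have h3 : (M : ℝ) ^ s = (M : ℝ) ^ hits g s x * (M : ℝ) ^ (s - hits g s x) := by
    rw [← pow_add, Nat.add_sub_cancel' (hits_le s x)]
  rw [h3, ← mul_assoc, ← mul_pow]
  congr 2
  field_simp

theorem isSelected_iff (hM : 0 < M) (s : ℕ) :
    isSelected g D M s = true ↔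
      (D : ℝ) ≤ ∑ x ∈ Finset.range D,
        if (g s).testBit x = true then weight g D M s x else 0 := by
  have hM' : (0 : ℝ) < (M : ℝ) ^ s := by positivity
  rw [isSelected, decide_eq_true_iff, ← Nat.cast_le (α := ℝ), scaledWeight_eq hM]
  push_cast
  exact mul_le_mul_iff_left₀ hM'

theorem covered_cons (a : ℕ) (L : List ℕ) (x : ℕ) :
    Covered (a :: L) x ↔ a.testBit x = true ∨ Covered L x := by
  simp [Covered]

theorem weight_succ_of_isSelected {s : ℕ} (h : isSelected g D M s = true) (x : ℕ) :
    weight g D M (s + 1) x =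
      weight g D M s x - if (g s).testBit x = true then weight g D M s x else 0 := by
  unfold weight
  rw [selected_succ, if_pos h, hits_succ]
  by_cases h1 : (g s).testBit x = true <;> simp [covered_cons, h1]

theorem weight_succ_of_not_isSelected {s : ℕ} (h : ¬ isSelected g D M s = true) (x : ℕ) :
    weight g D M (s + 1) x =
      weight g D M s x +
        (1 / (M : ℝ)) * if (g s).testBit x = true then weight g D M s x else 0 := by
  unfold weight
  rw [selected_succ, if_neg h, hits_succ]
  by_cases h1 : (g s).testBit x = true <;> by_cases h2 : Covered (selected g D M s) x <;>
    simp [h1, h2, pow_succ]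
  ring

/-- The left side is a potential that starts at `D`. Selecting a set adds `D` but removes its
uncovered weight, which is at least `D`. Rejecting a nonempty set adds `1/M` of a weight below `D`.
An empty set changes nothing. -/
theorem sum_weight_le (hM : 0 < M) (s : ℕ) :
    (∑ x ∈ Finset.range D, weight g D M s x) + D * (selected g D M s).length ≤
      D + D / M * (Nat.count (fun t => g t ≠ 0) s : ℕ) := by
  have hM' : (0 : ℝ) < (M : ℝ) := by positivity
  induction s with
  | zero => simp [weight, selected, Covered, hits]
  | succ s ih =>
    by_cases h : isSelected g D M s = true
    · have h1 := (isSelected_iff hM s).1 h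
      simp only [weight_succ_of_isSelected h, Finset.sum_sub_distrib]
      have h3 : (Nat.count (fun t => g t ≠ 0) s : ℝ) ≤ (Nat.count (fun t => g t ≠ 0) (s + 1) : ℕ) :=
        Nat.cast_le.2 (Nat.count_monotone _ (Nat.le_succ s))
      have h4 : (D : ℝ) / M * (Nat.count (fun t => g t ≠ 0) s : ℕ) ≤
          D / M * (Nat.count (fun t => g t ≠ 0) (s + 1) : ℕ) := by gcongr
      rw [selected_succ, if_pos h, List.length_cons]
      push_cast
      linarith
    · have h1 := mt (isSelected_iff hM s).2 h
      simp only [weight_succ_of_not_isSelected h, Finset.sum_add_distrib, ← Finset.mul_sum]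
      rw [selected_succ, if_neg h]
      by_cases h0 : g s = 0
      · have : Nat.count (fun t => g t ≠ 0) (s + 1) = Nat.count (fun t => g t ≠ 0) s := by
          simp [Nat.count_succ, h0]
        rw [this]
        simpa [h0] using ih
      · have : Nat.count (fun t => g t ≠ 0) (s + 1) = Nat.count (fun t => g t ≠ 0) s + 1 := by
          simp [Nat.count_succ, h0]
        rw [this]
        push_cast
        have h5 := mul_le_mul_of_nonneg_left (not_le.1 h1).le (one_div_pos.2 hM').le
        rw [one_div_mul_eq_div (M : ℝ) (D : ℝ)] at h5
        linarith

/-- Few sets are selected. -/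
theorem count_isSelected_mul_le (hD : 0 < D) (hM : 0 < M) {s : ℕ}
    (h : isSelected g D M s = true) :
    Nat.count (fun t => isSelected g D M t = true) s * M ≤
      Nat.count (fun t => g t ≠ 0) (s + 1) := by
  have h1 := sum_weight_le (g := g) (D := D) hM (s + 1)
  have h2 : 0 ≤ ∑ x ∈ Finset.range D, weight g D M (s + 1) x :=
    Finset.sum_nonneg fun x _ => weight_nonneg _ _
  -- The selection at time `s` itself contributes one more `D`, which cancels the initial potential.
  rw [length_selected, Nat.count_succ, if_pos h] at h1
  have hM' : (0 : ℝ) < (M : ℝ) := by positivity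
  have hD' : (0 : ℝ) < (D : ℝ) := by positivity
  rw [← Nat.cast_le (α := ℝ)]
  push_cast at h1 ⊢
  set i : ℝ := ((Nat.count (fun t => isSelected g D M t = true) s : ℕ) : ℝ)
  set N : ℝ := ((Nat.count (fun t => g t ≠ 0) (s + 1) : ℕ) : ℝ)
  have h3 : (D : ℝ) * i ≤ D * (N / M) := by
    have : (D : ℝ) / M * N = D * (N / M) := by ring
    linarith
  rw [← le_div_iff₀ hM']
  exact le_of_mul_le_mul_left h3 hD'

/-- A number that belongs to many sets is covered. -/
theorem exists_isSelected (hM : 0 < M) {s x e : ℕ} (hx : x < D)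
    (hgx : (g s).testBit x = true) (he : M * e ≤ hits g s x) (hD : D ≤ 2 ^ e) :
    ∃ t, isSelected g D M t = true ∧ (g t).testBit x = true := by
  by_cases hc : Covered (selected g D M s) x
  · obtain ⟨a, ha, hax⟩ := hc
    obtain ⟨t, -, rfl, ht⟩ := exists_of_mem_selected ha
    exact ⟨t, ht, hax⟩
  -- By Bernoulli `(1 + 1/M) ^ M ≥ 2`, so `M * e` hits give the uncovered point `x` weight at least
  -- `2 ^ e ≥ D`, and `x` alone makes `g s` reach the threshold.
  · refine ⟨s, (isSelected_iff hM s).2 ?_, hgx⟩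
    have hM' : (0 : ℝ) < (M : ℝ) := by positivity
    have h1 : (2 : ℝ) ≤ (1 + 1 / (M : ℝ)) ^ M := by
      have := one_add_mul_le_pow (a := 1 / (M : ℝ)) (by have := one_div_pos.2 hM'; linarith) M
      rw [mul_one_div_cancel hM'.ne'] at this
      linarith
    have h2 : (D : ℝ) ≤ weight g D M s x := by
      rw [weight, if_neg hc]
      calc (D : ℝ) ≤ 2 ^ e := by exact_mod_cast hD
        _ ≤ ((1 + 1 / (M : ℝ)) ^ M) ^ e := by gcongr
        _ = (1 + 1 / (M : ℝ)) ^ (M * e) := (pow_mul _ _ _).symm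
        _ ≤ _ := pow_le_pow_right₀ (by have := one_div_pos.2 hM'; linarith) he
    refine h2.trans ?_
    have h3 := Finset.single_le_sum (s := Finset.range D)
      (f := fun x => if (g s).testBit x = true then weight g D M s x else 0)
      (fun x _ => by split <;> [exact weight_nonneg s x; exact le_rfl])
      (Finset.mem_range.2 hx)
    simpa [hgx] using h3

end Covering

/-! ### The selection is primitive recursive -/

section Primrec

variable {α : Type*} [Primcodable α] {g : α → ℕ → ℕ} {D M : α → ℕ}

theorem primrec_hits (hg : Primrec₂ g) :
    Primrec fun p : α × ℕ × ℕ => hits (g p.1) p.2.1 p.2.2 := by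
  have hb : Primrec₂ fun (q : α × ℕ) t => (g q.1 t).testBit q.2 :=
    primrec_nat_testBit.comp (hg.comp (Primrec.fst.comp Primrec.fst) Primrec.snd)
      (Primrec.snd.comp Primrec.fst)
  exact (primrec_nat_count hb).comp
    (Primrec.pair Primrec.fst (Primrec.snd.comp Primrec.snd)) (Primrec.fst.comp Primrec.snd)

theorem primrecRel_covered : PrimrecRel Covered :=
  PrimrecRel.exists_mem_list
    (PrimrecRel.comp Primrec.eq primrec_nat_testBit (Primrec.const true))

theorem primrec_scaledWeight (hg : Primrec₂ g) (hD : Primrec D) (hM : Primrec M) :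
    Primrec fun p : α × ℕ × List ℕ => scaledWeight (g p.1) (D p.1) (M p.1) p.2.1 p.2.2 := by
  have hh : Primrec fun q : (α × ℕ × List ℕ) × ℕ => hits (g q.1.1) q.1.2.1 q.2 :=
    (primrec_hits hg).comp (Primrec.pair (Primrec.fst.comp Primrec.fst)
      (Primrec.pair (Primrec.fst.comp (Primrec.snd.comp Primrec.fst)) Primrec.snd))
  have hf : Primrec₂ fun (p : α × ℕ × List ℕ) x =>
      if (g p.1 p.2.1).testBit x = true ∧ ¬ Covered p.2.2 x then
        (M p.1 + 1) ^ hits (g p.1) p.2.1 x * M p.1 ^ (p.2.1 - hits (g p.1) p.2.1 x)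
      else 0 := by
    have hMq : Primrec fun q : (α × ℕ × List ℕ) × ℕ => M q.1.1 :=
      hM.comp (Primrec.fst.comp Primrec.fst)
    refine Primrec.ite (PrimrecPred.and ?_ (PrimrecPred.not ?_)) ?_ (Primrec.const 0)
    · exact PrimrecRel.comp Primrec.eq (primrec_nat_testBit.comp
        (hg.comp (Primrec.fst.comp Primrec.fst) (Primrec.fst.comp (Primrec.snd.comp Primrec.fst)))
        Primrec.snd) (Primrec.const true)
    · exact PrimrecRel.comp primrecRel_covered
        (Primrec.snd.comp (Primrec.snd.comp Primrec.fst)) Primrec.snd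
    · exact Primrec.nat_mul.comp
        (primrec_nat_pow.comp (Primrec.succ.comp hMq) hh)
        (primrec_nat_pow.comp hMq (Primrec.nat_sub.comp
          (Primrec.fst.comp (Primrec.snd.comp Primrec.fst)) hh))
  exact (primrec_sum_range hf).comp Primrec.id (hD.comp Primrec.fst)

theorem primrecPred_selected_aux (hg : Primrec₂ g) (hD : Primrec D) (hM : Primrec M) :
    PrimrecPred fun p : α × ℕ × List ℕ =>
      D p.1 * M p.1 ^ p.2.1 ≤ scaledWeight (g p.1) (D p.1) (M p.1) p.2.1 p.2.2 :=
  PrimrecRel.comp Primrec.nat_le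
    (Primrec.nat_mul.comp (hD.comp Primrec.fst)
      (primrec_nat_pow.comp (hM.comp Primrec.fst) (Primrec.fst.comp Primrec.snd)))
    (primrec_scaledWeight hg hD hM)

theorem primrec_selected (hg : Primrec₂ g) (hD : Primrec D) (hM : Primrec M) :
    Primrec₂ fun a s => selected (g a) (D a) (M a) s := by
  have h : Primrec₂ fun a s => Nat.rec (motive := fun _ => List ℕ) []
      (fun s L => if D a * M a ^ s ≤ scaledWeight (g a) (D a) (M a) s L then g a s :: L else L) s :=
    Primrec.nat_rec (Primrec.const [])
      (Primrec.ite (primrecPred_selected_aux hg hD hM)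
        (Primrec.list_cons.comp (hg.comp Primrec.fst (Primrec.fst.comp Primrec.snd))
          (Primrec.snd.comp Primrec.snd))
        (Primrec.snd.comp Primrec.snd)).to₂
  refine h.of_eq fun a s => ?_
  induction s with
  | zero => rfl
  | succ s ih => rw [selected, ← ih]

theorem primrec_isSelected (hg : Primrec₂ g) (hD : Primrec D) (hM : Primrec M) :
    Primrec₂ fun a s => isSelected (g a) (D a) (M a) s :=
  (primrecPred_selected_aux hg hD hM).decide.comp
    (Primrec.pair Primrec.fst (Primrec.pair Primrec.snd (primrec_selected hg hD hM)))

end Primrec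

/-! ### Enumeration of the sets of small complexity -/

open Nat.Partrec (Code)

/-- The output of the program `q` (with empty condition), given at the only time `t` at which
the computation of the code `c` on this program is discovered to halt. -/
def firing (c : Code) (q : List Bool) (t : ℕ) : Option (List Bool) :=
  if (Code.evaln t c (Encodable.encode (q, ([] : List Bool)))).isSome = true then none
  else (Code.evaln (t + 1) c (Encodable.encode (q, ([] : List Bool)))).bind Encodable.decode

theorem primrec_firing (c : Code) : Primrec₂ (firing c) := by
  have hq : Primrec fun p : List Bool × ℕ => Encodable.encode (p.1, ([] : List Bool)) :=
    Primrec.encode.comp (Primrec.pair Primrec.fst (Primrec.const []))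
  have h1 : Primrec fun p : List Bool × ℕ =>
      Code.evaln p.2 c (Encodable.encode (p.1, ([] : List Bool))) :=
    Code.primrec_evaln.comp (Primrec.pair (Primrec.pair Primrec.snd (Primrec.const c)) hq)
  have h2 : Primrec fun p : List Bool × ℕ =>
      Code.evaln (p.2 + 1) c (Encodable.encode (p.1, ([] : List Bool))) :=
    Code.primrec_evaln.comp
      (Primrec.pair (Primrec.pair (Primrec.succ.comp Primrec.snd) (Primrec.const c)) hq)
  exact Primrec.ite
    (PrimrecRel.comp Primrec.eq (Primrec.option_isSome.comp h1) (Primrec.const true))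
    (Primrec.const none)
    (Primrec.option_bind h2 (Primrec.decode.comp Primrec.snd).to₂)

/-- Halting within a bound persists for larger bounds. Uniqueness makes each program contribute at
most one arrival. -/
theorem firing_unique {c : Code} {q : List Bool} {t t' : ℕ}
    (h : (firing c q t).isSome = true) (h' : (firing c q t').isSome = true) : t = t' := by
  have key : ∀ {t t' : ℕ}, (firing c q t).isSome = true → (firing c q t').isSome = true →
      ¬ t < t' := by
    intro t t' h h' hlt
    unfold firing at h h'
    split_ifs at h with h1
    · simp at h
    · obtain ⟨z, hz⟩ := Option.isSome_iff_exists.1 h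
      obtain ⟨m, hm, -⟩ := Option.bind_eq_some_iff.1 hz
      rw [if_pos (Option.isSome_iff_exists.2 ⟨m, Code.evaln_mono hlt hm⟩)] at h'
      simp at h'
  exact le_antisymm (not_lt.1 (key h' h)) (not_lt.1 (key h h'))

theorem exists_firing {c : Code} {q z : List Bool}
    (h : Encodable.encode z ∈ Code.eval c (Encodable.encode (q, ([] : List Bool)))) :
    ∃ t, firing c q t = some z := by
  classical
  have hex : ∃ k, (Code.evaln k c (Encodable.encode (q, ([] : List Bool)))).isSome = true := by
    obtain ⟨k, hk⟩ := Code.evaln_complete.1 h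
    exact ⟨k, Option.isSome_iff_exists.2 ⟨_, hk⟩⟩
  obtain ⟨k, hk, hmin⟩ := Nat.findX hex
  cases k with
  | zero => simp [Code.evaln] at hk
  | succ k =>
    refine ⟨k, ?_⟩
    obtain ⟨m, hm⟩ := Option.isSome_iff_exists.1 hk
    have hmz : m = Encodable.encode z := Part.mem_unique (Code.evaln_sound hm) h
    rw [firing, if_neg (hmin k (Nat.lt_succ_self k)), hm, hmz]
    simp

/-- The set with code `z`, which is a set of strings with numbers below `D`, belongs to
the family with code `F`, and the binary logarithm of its size is `l` after rounding up. -/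
def Admissible (D l : ℕ) (F z : List Bool) : Prop :=
  (strToNat F).testBit (strToNat z) = true ∧
    Nat.count (fun i => (strToNat z).testBit i = true) D ≤ 2 ^ l ∧
    2 ^ l < 2 * Nat.count (fun i => (strToNat z).testBit i = true) D

instance (D l : ℕ) (F z : List Bool) : Decidable (Admissible D l F z) :=
  inferInstanceAs (Decidable (_ ∧ _ ∧ _))

/-- The admissible output that arrives at time `s` in the enumeration of the outputs of all
programs of length at most `m`. -/
def arrival (c : Code) (D m l : ℕ) (F : List Bool) (s : ℕ) : Option (List Bool) :=
  -- `decode₂` accepts only genuine codes, so distinct times belong to distinct pairs. The test on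
  -- `strToNat p.1` admits all strings of length at most `m` and one of length `m + 1`, exactly `2 ^
  -- (m + 1)` in total.
  (Encodable.decode₂ (List Bool × ℕ) s).bind fun p => (firing c p.1 p.2).bind fun z =>
    if strToNat p.1 < 2 ^ (m + 1) ∧ Admissible D l F z then some z else none

/-- The number of the set that arrives at time `s`, and `0` if there is none. -/
def arrivalNum (c : Code) (D m l : ℕ) (F : List Bool) (s : ℕ) : ℕ :=
  ((arrival c D m l F s).map strToNat).getD 0

section Arrival

variable {c : Code} {D m l : ℕ} {F : List Bool}

theorem arrival_eq_some_iff {s : ℕ} {z : List Bool} :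
    arrival c D m l F s = some z ↔
      ∃ q t, Encodable.encode (q, t) = s ∧ firing c q t = some z ∧
        strToNat q < 2 ^ (m + 1) ∧ Admissible D l F z := by
  simp only [arrival, Option.bind_eq_some_iff, Prod.exists, ← Option.mem_def (a := (_, _)),
    Encodable.mem_decode₂]
  constructor
  · rintro ⟨q, t, hs, z', hz', h⟩
    split_ifs at h with h1
    obtain rfl := Option.some.inj h
    exact ⟨q, t, hs, hz', h1⟩
  · rintro ⟨q, t, hs, hz, h⟩
    exact ⟨q, t, hs, z, hz, if_pos h⟩

theorem admissible_of_arrival {s : ℕ} {z : List Bool} (h : arrival c D m l F s = some z) :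
    Admissible D l F z := by
  obtain ⟨q, t, -, -, -, h⟩ := arrival_eq_some_iff.1 h
  exact h

theorem exists_arrival {q z : List Bool}
    (h : Encodable.encode z ∈ Code.eval c (Encodable.encode (q, ([] : List Bool))))
    (hq : q.length ≤ m) (hz : Admissible D l F z) : ∃ s, arrival c D m l F s = some z := by
  obtain ⟨t, ht⟩ := exists_firing h
  refine ⟨Encodable.encode (q, t), arrival_eq_some_iff.2 ⟨q, t, rfl, ht, ?_, hz⟩⟩
  have h1 := strToNat_lt q
  have h2 : 2 ^ (q.length + 1) ≤ 2 ^ (m + 1) := Nat.pow_le_pow_right (by norm_num) (by omega)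
  omega

theorem arrival_of_arrivalNum_ne_zero {s : ℕ} (h : arrivalNum c D m l F s ≠ 0) :
    ∃ z, arrival c D m l F s = some z ∧ arrivalNum c D m l F s = strToNat z := by
  unfold arrivalNum at h ⊢
  cases hz : arrival c D m l F s with
  | none => simp [hz] at h
  | some z => exact ⟨z, rfl, rfl⟩

theorem arrivalNum_of_arrival {s : ℕ} {z : List Bool} (h : arrival c D m l F s = some z) :
    arrivalNum c D m l F s = strToNat z := by
  simp [arrivalNum, h]

/-- Sending an arrival to its program is injective by `firing_unique`. A set produced by several
programs arrives several times, which does no harm. -/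
theorem count_arrivalNum_le (s : ℕ) :
    Nat.count (fun t => arrivalNum c D m l F t ≠ 0) s ≤ 2 ^ (m + 1) := by
  have key : ∀ t : {t // t ∈ (Finset.range s).filter fun t => arrivalNum c D m l F t ≠ 0},
      ∃ p : List Bool × ℕ, Encodable.encode p = t.1 ∧ (firing c p.1 p.2).isSome = true ∧
        strToNat p.1 < 2 ^ (m + 1) := by
    rintro ⟨t, ht⟩
    obtain ⟨z, hz, -⟩ := arrival_of_arrivalNum_ne_zero (Finset.mem_filter.1 ht).2
    obtain ⟨q, u, hqu, hf, hq, -⟩ := arrival_eq_some_iff.1 hz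
    exact ⟨(q, u), hqu, Option.isSome_iff_exists.2 ⟨z, hf⟩, hq⟩
  choose p hp hfire hlt using key
  rw [Nat.count_eq_card_filter_range, ← Finset.card_attach, ← Finset.card_range (2 ^ (m + 1))]
  refine Finset.card_le_card_of_injOn (fun t => strToNat (p t).1)
    (fun t _ => Finset.mem_coe.2 (Finset.mem_range.2 (hlt t))) fun t _ t' _ htt => ?_
  have h1 : (p t).1 = (p t').1 := strToNat_injective htt
  have h2 := hfire t'
  rw [← h1] at h2
  have h3 : p t = p t' := Prod.ext h1 (firing_unique (hfire t) h2)
  exact Subtype.ext (by rw [← hp t, ← hp t', h3])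

end Arrival

section Primrec

variable {α : Type*} [Primcodable α] {D m l : α → ℕ} {F : α → List Bool}

theorem primrecPred_admissible (hD : Primrec D) (hl : Primrec l) (hF : Primrec F)
    {z : α → List Bool} (hz : Primrec z) :
    PrimrecPred fun a => Admissible (D a) (l a) (F a) (z a) := by
  have hcount : Primrec fun a => Nat.count (fun i => (strToNat (z a)).testBit i = true) (D a) :=
    (primrec_nat_count (b := fun a i => (strToNat (z a)).testBit i)
      (primrec_nat_testBit.comp ((primrec_strToNat.comp hz).comp Primrec.fst)
        Primrec.snd)).comp Primrec.id hD
  have hpow : Primrec fun a => 2 ^ l a := primrec_nat_pow.comp (Primrec.const 2) hl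
  exact PrimrecPred.and
    (PrimrecRel.comp Primrec.eq (primrec_nat_testBit.comp (primrec_strToNat.comp hF)
      (primrec_strToNat.comp hz)) (Primrec.const true))
    (PrimrecPred.and (PrimrecRel.comp Primrec.nat_le hcount hpow)
      (PrimrecRel.comp Primrec.nat_lt hpow (Primrec.nat_mul.comp (Primrec.const 2) hcount)))

theorem primrec_arrival (c : Code) (hD : Primrec D) (hm : Primrec m) (hl : Primrec l)
    (hF : Primrec F) : Primrec₂ fun a s => arrival c (D a) (m a) (l a) (F a) s := by
  have h1 : Primrec fun p : ((α × ℕ) × List Bool × ℕ) × List Bool => p.1.1.1 :=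
    Primrec.fst.comp (Primrec.fst.comp Primrec.fst)
  have h2 : PrimrecPred fun p : ((α × ℕ) × List Bool × ℕ) × List Bool =>
      strToNat p.1.2.1 < 2 ^ (m p.1.1.1 + 1) ∧
        Admissible (D p.1.1.1) (l p.1.1.1) (F p.1.1.1) p.2 :=
    PrimrecPred.and
      (PrimrecRel.comp Primrec.nat_lt
        (primrec_strToNat.comp (Primrec.fst.comp (Primrec.snd.comp Primrec.fst)))
        (primrec_nat_pow.comp (Primrec.const 2) (Primrec.succ.comp (hm.comp h1))))
      (primrecPred_admissible (hD.comp h1) (hl.comp h1) (hF.comp h1) Primrec.snd)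
  have h3 : Primrec fun p : (α × ℕ) × List Bool × ℕ => firing c p.2.1 p.2.2 :=
    (primrec_firing c).comp (Primrec.fst.comp Primrec.snd) (Primrec.snd.comp Primrec.snd)
  exact Primrec.option_bind (Primrec.decode₂.comp Primrec.snd)
    (Primrec.option_bind h3
      (Primrec.ite h2 (Primrec.option_some.comp Primrec.snd) (Primrec.const none)).to₂).to₂

theorem primrec_arrivalNum (c : Code) (hD : Primrec D) (hm : Primrec m) (hl : Primrec l)
    (hF : Primrec F) : Primrec₂ fun a s => arrivalNum c (D a) (m a) (l a) (F a) s :=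
  Primrec.option_getD.comp
    (Primrec.option_map (primrec_arrival c hD hm hl hF) (primrec_strToNat.comp Primrec.snd).to₂)
    (Primrec.const 0)

end Primrec

/-! ### The two descriptions -/

/-- The sets `z` that arrive and contain the string `y`, for the parameters `n, m, l`. -/
def arrivalContaining (c : Code) (w : (ℕ × ℕ × ℕ) × List Bool × List Bool) (s : ℕ) :
    Option (List Bool) :=
  if (arrivalNum c (2 ^ (w.1.1 + 1)) w.1.2.1 w.1.2.2 w.2.1 s).testBit (strToNat w.2.2) = true then
    arrival c (2 ^ (w.1.1 + 1)) w.1.2.1 w.1.2.2 w.2.1 s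
  else none

/-- The sets that arrive and are selected, for the parameters `r, n, m, l`. -/
def arrivalSelected (c : Code) (w : (ℕ × ℕ × ℕ × ℕ) × List Bool) (s : ℕ) :
    Option (List Bool) :=
  if isSelected (arrivalNum c (2 ^ (w.1.2.1 + 1)) w.1.2.2.1 w.1.2.2.2 w.2)
      (2 ^ (w.1.2.1 + 1)) (2 ^ w.1.1) s = true then
    arrival c (2 ^ (w.1.2.1 + 1)) w.1.2.2.1 w.1.2.2.2 w.2 s
  else none

theorem primrec_arrivalContaining (c : Code) : Primrec₂ (arrivalContaining c) := by
  have hn : Primrec fun w : (ℕ × ℕ × ℕ) × List Bool × List Bool => w.1.1 :=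
    Primrec.fst.comp Primrec.fst
  have hD : Primrec fun w : (ℕ × ℕ × ℕ) × List Bool × List Bool => 2 ^ (w.1.1 + 1) :=
    primrec_nat_pow.comp (Primrec.const 2) (Primrec.succ.comp hn)
  have hm : Primrec fun w : (ℕ × ℕ × ℕ) × List Bool × List Bool => w.1.2.1 :=
    Primrec.fst.comp (Primrec.snd.comp Primrec.fst)
  have hl : Primrec fun w : (ℕ × ℕ × ℕ) × List Bool × List Bool => w.1.2.2 :=
    Primrec.snd.comp (Primrec.snd.comp Primrec.fst)
  have hF : Primrec fun w : (ℕ × ℕ × ℕ) × List Bool × List Bool => w.2.1 :=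
    Primrec.fst.comp Primrec.snd
  have hy : Primrec fun q : ((ℕ × ℕ × ℕ) × List Bool × List Bool) × ℕ => strToNat q.1.2.2 :=
    primrec_strToNat.comp (Primrec.snd.comp (Primrec.snd.comp Primrec.fst))
  have hg := primrec_arrivalNum c hD hm hl hF
  have ha := primrec_arrival c hD hm hl hF
  have hp := (primrec_nat_testBit.comp hg hy)
  have h := Primrec.ite (PrimrecRel.comp Primrec.eq hp (Primrec.const true)) ha
    (Primrec.const none)
  exact h.of_eq fun _ => rfl

theorem primrec_arrivalSelected (c : Code) : Primrec₂ (arrivalSelected c) := by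
  have hM : Primrec fun w : (ℕ × ℕ × ℕ × ℕ) × List Bool => 2 ^ w.1.1 :=
    primrec_nat_pow.comp (Primrec.const 2) (Primrec.fst.comp Primrec.fst)
  have hn : Primrec fun w : (ℕ × ℕ × ℕ × ℕ) × List Bool => w.1.2.1 :=
    Primrec.fst.comp (Primrec.snd.comp Primrec.fst)
  have hD : Primrec fun w : (ℕ × ℕ × ℕ × ℕ) × List Bool => 2 ^ (w.1.2.1 + 1) :=
    primrec_nat_pow.comp (Primrec.const 2) (Primrec.succ.comp hn)
  have hm : Primrec fun w : (ℕ × ℕ × ℕ × ℕ) × List Bool => w.1.2.2.1 :=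
    Primrec.fst.comp (Primrec.snd.comp (Primrec.snd.comp Primrec.fst))
  have hl : Primrec fun w : (ℕ × ℕ × ℕ × ℕ) × List Bool => w.1.2.2.2 :=
    Primrec.snd.comp (Primrec.snd.comp (Primrec.snd.comp Primrec.fst))
  have hg := primrec_arrivalNum c hD hm hl Primrec.snd
  have ha := primrec_arrival c hD hm hl Primrec.snd
  have hp := primrec_isSelected hg hD hM
  have h := Primrec.ite (PrimrecRel.comp Primrec.eq hp (Primrec.const true)) ha
    (Primrec.const none)
  exact h.of_eq fun _ => rfl

section Descriptions

variable {U : List Bool → List Bool →. List Bool}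

/-- The description of `B` given `x`: its index among the arrivals containing `x`. -/
theorem condC_le_of_arrival_hits (hU : IsReferenceMachine U) (c : Code) :
    ∃ k : ℕ, ∀ (n m l : ℕ) (v F y z : List Bool) (s : ℕ), F ∈ U v [] →
      arrival c (2 ^ (n + 1)) m l F s = some z → (strToNat z).testBit (strToNat y) = true →
      condC U z y ≤
        (natToStr (hits (arrivalNum c (2 ^ (n + 1)) m l F) s (strToNat y))).length +
          2 * (natToStr (Nat.pair n (Nat.pair m l))).length + 2 * v.length + k := by
  have hpar : Primrec fun p : ℕ × List Bool × List Bool =>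
      ((p.1.unpair.1, p.1.unpair.2.unpair), p.2) :=
    Primrec.pair (Primrec.pair (Primrec.fst.comp (Primrec.unpair.comp Primrec.fst))
      (Primrec.unpair.comp (Primrec.snd.comp (Primrec.unpair.comp Primrec.fst)))) Primrec.snd
  obtain ⟨k, hk⟩ := condC_le_of_enumerated hU (f := fun p =>
    arrivalContaining c ((p.1.unpair.1, p.1.unpair.2.unpair), p.2))
    ((primrec_arrivalContaining c).comp (hpar.comp Primrec.fst) Primrec.snd)
  refine ⟨k, fun n m l v F y z s hF hs hy => ?_⟩
  have h := hk (Nat.pair n (Nat.pair m l)) v F y z s hF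
  simp only [Nat.unpair_pair] at h
  have hcount : Nat.count (fun t => (arrivalContaining c ((n, m, l), F, y) t).isSome = true) s =
      hits (arrivalNum c (2 ^ (n + 1)) m l F) s (strToNat y) := by
    unfold hits
    congr 1
    ext t
    unfold arrivalContaining
    split_ifs with h
    · have h0 : arrivalNum c (2 ^ (n + 1)) m l F t ≠ 0 := by
        intro h0
        simp [h0] at h
      obtain ⟨z', hz', -⟩ := arrival_of_arrivalNum_ne_zero h0
      simp [hz', h]
    · simp [h]
  rw [hcount] at h
  refine h ?_
  rw [arrivalContaining, if_pos (by rwa [arrivalNum_of_arrival hs]), hs]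

/-- The unconditional description of `A`: its index among the selected arrivals. The parameter `r`
is part of it because the selection depends on `M = 2 ^ r`. -/
theorem condC_le_of_isSelected (hU : IsReferenceMachine U) (c : Code) :
    ∃ k : ℕ, ∀ (r n m l : ℕ) (v F z : List Bool) (s : ℕ), F ∈ U v [] →
      arrival c (2 ^ (n + 1)) m l F s = some z →
      isSelected (arrivalNum c (2 ^ (n + 1)) m l F) (2 ^ (n + 1)) (2 ^ r) s = true →
      condC U z [] ≤
        (natToStr (Nat.count (fun t =>
          isSelected (arrivalNum c (2 ^ (n + 1)) m l F) (2 ^ (n + 1)) (2 ^ r) t = true) s)).length +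
          2 * (natToStr (Nat.pair r (Nat.pair n (Nat.pair m l)))).length + 2 * v.length + k := by
  have hu : Primrec fun p : ℕ × List Bool × List Bool => p.1.unpair.2.unpair :=
    Primrec.unpair.comp (Primrec.snd.comp (Primrec.unpair.comp Primrec.fst))
  have hpar : Primrec fun p : ℕ × List Bool × List Bool =>
      ((p.1.unpair.1, p.1.unpair.2.unpair.1, p.1.unpair.2.unpair.2.unpair), p.2.1) :=
    Primrec.pair (Primrec.pair (Primrec.fst.comp (Primrec.unpair.comp Primrec.fst))
      (Primrec.pair (Primrec.fst.comp hu) (Primrec.unpair.comp (Primrec.snd.comp hu))))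
      (Primrec.fst.comp Primrec.snd)
  obtain ⟨k, hk⟩ := condC_le_of_enumerated hU (f := fun p => arrivalSelected c
    ((p.1.unpair.1, p.1.unpair.2.unpair.1, p.1.unpair.2.unpair.2.unpair), p.2.1))
    ((primrec_arrivalSelected c).comp (hpar.comp Primrec.fst) Primrec.snd)
  refine ⟨k, fun r n m l v F z s hF hs hsel => ?_⟩
  have h := hk (Nat.pair r (Nat.pair n (Nat.pair m l))) v F [] z s hF
  simp only [Nat.unpair_pair] at h
  have hcount : Nat.count (fun t => (arrivalSelected c ((r, n, m, l), F) t).isSome = true) s =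
      Nat.count (fun t =>
        isSelected (arrivalNum c (2 ^ (n + 1)) m l F) (2 ^ (n + 1)) (2 ^ r) t = true) s := by
    congr 1
    ext t
    unfold arrivalSelected
    split_ifs with h
    · obtain ⟨z', hz', -⟩ := arrival_of_arrivalNum_ne_zero
        (ne_zero_of_isSelected (by positivity) (by positivity) h)
      simp [hz', h]
    · simp [h]
  rw [hcount] at h
  refine h ?_
  rw [arrivalSelected, if_pos hsel, hs]

end Descriptions

/-! ### Logarithmic bounds -/

/-- The binary logarithm of `m + 1`. -/
noncomputable def logSucc (m : ℕ) : ℝ := Real.logb 2 ((m : ℝ) + 1)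

theorem logSucc_nonneg (m : ℕ) : 0 ≤ logSucc m :=
  Real.logb_nonneg (by norm_num) (by have := Nat.cast_nonneg (α := ℝ) m; linarith)

theorem logSucc_mono {m n : ℕ} (h : m ≤ n) : logSucc m ≤ logSucc n := by
  have h' : (m : ℝ) ≤ n := Nat.cast_le.2 h
  exact Real.logb_le_logb_of_le (by norm_num) (by positivity) (by linarith)

theorem logSucc_mul_le {a b m : ℕ} (h : m + 1 ≤ (a + 1) * (b + 1)) :
    logSucc m ≤ logSucc a + logSucc b := by
  unfold logSucc
  rw [← Real.logb_mul (by positivity) (by positivity)]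
  exact Real.logb_le_logb_of_le (by norm_num) (by positivity) (by exact_mod_cast h)

theorem logSucc_succ_le (m : ℕ) : logSucc (m + 1) ≤ logSucc m + 1 := by
  have h := logSucc_mul_le (a := m) (b := 1) (m := m + 1) (by omega)
  have h1 : logSucc 1 = 1 := by
    unfold logSucc
    norm_num
  linarith

theorem logSucc_le (m : ℕ) : logSucc m ≤ Real.logb 2 (m : ℝ) + 1 := by
  rcases Nat.eq_zero_or_pos m with rfl | hm
  · simp [logSucc]
  · have h1 : (1 : ℝ) ≤ m := Nat.one_le_cast.2 hm
    have h2 : Real.logb 2 (m : ℝ) + 1 = Real.logb 2 ((m : ℝ) * 2) := by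
      rw [Real.logb_mul (by positivity) (by norm_num), Real.logb_self_eq_one (by norm_num)]
    rw [h2]
    exact Real.logb_le_logb_of_le (by norm_num) (by positivity) (by linarith)

theorem logb_natCast_nonneg (m : ℕ) : 0 ≤ Real.logb 2 (m : ℝ) := by
  rcases Nat.eq_zero_or_pos m with rfl | hm
  · simp
  · exact Real.logb_nonneg (by norm_num) (Nat.one_le_cast.2 hm)

theorem logSucc_pair_le (a b : ℕ) : logSucc (Nat.pair a b) ≤ 2 * logSucc a + 2 * logSucc b := by
  have h1 : Nat.pair a b < (max a b + 1) ^ 2 := Nat.pair_lt_max_add_one_sq a b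
  have h2 : logSucc (Nat.pair a b) ≤ logSucc (max a b) + logSucc (max a b) :=
    logSucc_mul_le (by rw [← sq]; exact h1)
  have h3 : logSucc (max a b) ≤ logSucc a + logSucc b := by
    rcases le_total a b with h | h
    · rw [max_eq_right h]
      linarith [logSucc_nonneg a]
    · rw [max_eq_left h]
      linarith [logSucc_nonneg b]
  linarith

theorem length_natToStr_le (m : ℕ) : ((natToStr m).length : ℝ) ≤ logSucc m := by
  have h := two_pow_length_le (natToStr m)
  rw [strToNat_natToStr] at h
  rw [logSucc, Real.le_logb_iff_rpow_le (by norm_num) (by positivity), Real.rpow_natCast]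
  exact_mod_cast h

/-! ### The sets of the family -/

section Family

variable {𝒜 : Set (Finset (List Bool))} {n : ℕ}

theorem mem_familyAt {A : Finset (List Bool)} :
    A ∈ familyAt 𝒜 n ↔ A ∈ 𝒜 ∧ ∀ x ∈ A, x.length = n := by
  classical
  simp only [familyAt, Finset.mem_filter, Finset.mem_powerset, Finset.subset_iff,
    mem_wordsOfLength]
  exact and_comm

theorem card_le_two_pow {A : Finset (List Bool)} (hA : ∀ x ∈ A, x.length = n) :
    A.card ≤ 2 ^ n := by
  have h1 : A ⊆ wordsOfLength n := fun x hx => (mem_wordsOfLength n x).2 (hA x hx)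
  refine (Finset.card_le_card h1).trans (Finset.card_image_le.trans ?_)
  simp

theorem admissible_iff {F : List Bool} {A : Finset (List Bool)} {l : ℕ}
    (hF : F = setCode ((familyAt 𝒜 n).image setCode)) (hA : A ∈ familyAt 𝒜 n) :
    Admissible (2 ^ (n + 1)) l F (setCode A) ↔ A.card ≤ 2 ^ l ∧ 2 ^ l < 2 * A.card := by
  have h : ∀ x ∈ A, strToNat x < 2 ^ (n + 1) := fun x hx => by
    have := strToNat_lt x
    rw [(mem_familyAt.1 hA).2 x hx] at this
    omega
  rw [Admissible, count_testBit_setCode A _ h, hF, testBit_setCode]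
  exact and_iff_right (Finset.mem_image_of_mem _ hA)

theorem exists_of_admissible {F z : List Bool} {D l : ℕ}
    (hF : F = setCode ((familyAt 𝒜 n).image setCode)) (h : Admissible D l F z) :
    ∃ A ∈ familyAt 𝒜 n, setCode A = z := by
  have h1 := h.1
  rw [hF, testBit_setCode] at h1
  exact Finset.mem_image.1 h1

/-- Turns the rounded logarithm into the inequalities tested by `Admissible`. -/
theorem clog_eq_iff {a l : ℕ} (ha : 0 < a) : Nat.clog 2 a = l ↔ a ≤ 2 ^ l ∧ 2 ^ l < 2 * a := by
  constructor
  · rintro rfl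
    refine ⟨Nat.le_pow_clog (by norm_num) a, ?_⟩
    rcases Nat.lt_or_ge 1 a with h1 | h1
    · have h2 := Nat.pow_pred_clog_lt_self (b := 2) (by norm_num) h1
      have h3 : 0 < Nat.clog 2 a := Nat.clog_pos (by norm_num) h1
      obtain ⟨k, hk⟩ := Nat.exists_eq_succ_of_ne_zero h3.ne'
      rw [hk] at h2 ⊢
      rw [pow_succ]
      simp only [Nat.pred_succ] at h2
      omega
    · obtain rfl : a = 1 := by omega
      simp
  · rintro ⟨h1, h2⟩
    refine le_antisymm ((Nat.clog_le_iff_le_pow (by norm_num)).2 h1) ?_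
    by_contra! h
    have h3 : a ≤ 2 ^ Nat.clog 2 a := Nat.le_pow_clog (by norm_num) a
    have h4 : 2 ^ (Nat.clog 2 a + 1) ≤ 2 ^ l := Nat.pow_le_pow_right (by norm_num) h
    rw [pow_succ] at h4
    omega

end Family

/-! ### The main estimate -/

/-- The cost of describing `𝒜ₙ` stays explicit: each of the two descriptions contains its program
twice, which gives the factor 4. The constants 64 are not optimized. -/
theorem exists_small_complexity {U : List Bool → List Bool →. List Bool}
    (hU : IsReferenceMachine U) {𝒜 : Set (Finset (List Bool))} (h𝒜 : IsDistortionFamily 𝒜)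
    (h2 : Property2 𝒜) :
    ∃ c : ℕ, ∀ x : List Bool, ∀ B ∈ 𝒜, x ∈ B → ∃ A ∈ 𝒜, x ∈ A ∧
      Nat.clog 2 A.card = Nat.clog 2 B.card ∧
      (CSet U A : ℝ) ≤ (algInfo U x B : ℝ) + 64 * (logSucc (CSet U B) + logSucc x.length) +
        4 * (CFamily U (familyAt 𝒜 x.length) : ℝ) + c := by
  obtain ⟨c, hc⟩ := Code.exists_code.1 hU.1
  obtain ⟨k₁, hk₁⟩ := condC_le_of_arrival_hits hU c
  obtain ⟨k₂, hk₂⟩ := condC_le_of_isSelected hU c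
  refine ⟨k₁ + k₂ + 64, fun x B hB hxB => ?_⟩
  set n := x.length with hn
  set m := CSet U B with hm
  set l := Nat.clog 2 B.card with hl
  set F := setCode ((familyAt 𝒜 n).image setCode) with hF
  obtain ⟨v, hv, hvF⟩ := hU.exists_program F []
  have hvC : v.length = CFamily U (familyAt 𝒜 n) := hv
  have hBn : B ∈ familyAt 𝒜 n := mem_familyAt.2 ⟨hB, fun y hy => h2 B hB y hy x hxB⟩
  have hadm : Admissible (2 ^ (n + 1)) l F (setCode B) :=
    (admissible_iff hF hBn).2 ((clog_eq_iff (h𝒜 B hB).card_pos).1 rfl)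
  have hln : l ≤ n :=
    (Nat.clog_le_iff_le_pow (by norm_num)).2 (card_le_two_pow (mem_familyAt.1 hBn).2)
  obtain ⟨q, hqm, hqB⟩ := hU.exists_program (setCode B) []
  have hcode : Encodable.encode (setCode B) ∈
      Code.eval c (Encodable.encode (q, ([] : List Bool))) := by
    rw [hc]
    simpa using hqB
  obtain ⟨s, hs⟩ := exists_arrival (D := 2 ^ (n + 1)) (m := m) hcode hqm.le hadm
  set g := arrivalNum c (2 ^ (n + 1)) m l F with hg
  have hgs : (g s).testBit (strToNat x) = true := by
    rw [hg, arrivalNum_of_arrival hs]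
    exact (testBit_setCode B x).2 hxB
  have hcond := hk₁ n m l v F x (setCode B) s hvF hs ((testBit_setCode B x).2 hxB)
  rw [← hg] at hcond
  set j := hits g s (strToNat x) with hj
  -- Every hit is a nonzero arrival.
  have hjm : j ≤ 2 ^ (m + 1) := by
    refine le_trans ?_ (count_arrivalNum_le (c := c) (D := 2 ^ (n + 1)) (l := l) (F := F) s)
    rw [← hg, hj, hits, Nat.count_eq_card_filter_range, Nat.count_eq_card_filter_range]
    refine Finset.card_le_card (Finset.monotone_filter_right _ fun t _ ht h0 => ?_)
    simp [h0] at ht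
  have hcondR : (condCSet U B x : ℝ) ≤ (natToStr j).length +
      2 * logSucc (Nat.pair n (Nat.pair m l)) + 2 * v.length + k₁ := by
    have h3 : (condCSet U B x : ℝ) ≤ (natToStr j).length +
        2 * (natToStr (Nat.pair n (Nat.pair m l))).length + 2 * v.length + k₁ := by
      exact_mod_cast hcond
    linarith [length_natToStr_le (Nat.pair n (Nat.pair m l))]
  have hpair : logSucc (Nat.pair n (Nat.pair m l)) ≤ 6 * logSucc n + 4 * logSucc m := by
    have h3 := logSucc_pair_le n (Nat.pair m l)
    have h4 := logSucc_pair_le m l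
    have h5 := logSucc_mono hln
    linarith
  have hLn := logSucc_nonneg n
  have hLm := logSucc_nonneg m
  have hinfo : (algInfo U x B : ℝ) = (m : ℝ) - (condCSet U B x : ℝ) := by
    rw [algInfo]
    push_cast
    rfl
  rw [hinfo, ← hvC]
  have hv0 : (0 : ℝ) ≤ v.length := Nat.cast_nonneg _
  have hk₁0 : (0 : ℝ) ≤ k₁ := Nat.cast_nonneg _
  have hk₂0 : (0 : ℝ) ≤ k₂ := Nat.cast_nonneg _
  push_cast
  -- For `j ≤ n` the conditional complexity of `B` is already logarithmic, so `A = B` works.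
  -- Otherwise `j / (n + 1)` is positive and has a logarithm.
  by_cases hjn : j ≤ n
  · refine ⟨B, hB, hxB, rfl, ?_⟩
    have h3 := length_natToStr_le j
    have h4 := logSucc_mono hjn
    rw [← hm]
    linarith
  · set r := Nat.log 2 (j / (n + 1)) with hr
    have hj0 : j / (n + 1) ≠ 0 := (Nat.div_pos (by omega) (by omega)).ne'
    have hr1 : 2 ^ r ≤ j / (n + 1) := Nat.pow_log_le_self 2 hj0
    have hr2 : j / (n + 1) < 2 ^ (r + 1) := Nat.lt_pow_succ_log_self (by norm_num) _
    have hr3 : 2 ^ r * (n + 1) ≤ j := (Nat.le_div_iff_mul_le (by omega)).1 hr1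
    have hr4 : j < 2 ^ (r + 1) * (n + 1) := (Nat.div_lt_iff_lt_mul (by omega)).1 hr2
    have hrm : r ≤ m + 1 := by
      have h3 : 2 ^ r ≤ 2 ^ (m + 1) := (hr1.trans (Nat.div_le_self _ _)).trans hjm
      exact (Nat.pow_le_pow_iff_right (by norm_num)).1 h3
    have hxD : strToNat x < 2 ^ (n + 1) := (Nat.lt_succ_self _).trans (strToNat_lt x)
    -- Here `e = n + 1`: the strings of length `n` have numbers below `D = 2 ^ (n + 1)`, and `hr3`
    -- supplies the `M * e` hits.
    obtain ⟨t, ht, htx⟩ := exists_isSelected (g := g) (D := 2 ^ (n + 1)) (M := 2 ^ r)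
      (by positivity) hxD hgs hr3 le_rfl
    obtain ⟨z, hz, hgz⟩ := arrival_of_arrivalNum_ne_zero
      (ne_zero_of_isSelected (by positivity) (by positivity) ht)
    have hzadm := admissible_of_arrival hz
    obtain ⟨A, hA, rfl⟩ := exists_of_admissible hF hzadm
    have hA𝒜 := (mem_familyAt.1 hA).1
    refine ⟨A, hA𝒜, ?_, ?_, ?_⟩
    · rw [hg, hgz] at htx
      exact (testBit_setCode A x).1 htx
    · exact (clog_eq_iff (h𝒜 A hA𝒜).card_pos).2 ((admissible_iff hF hA).1 hzadm)
    have hsel := hk₂ r n m l v F (setCode A) t hvF hz ht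
    rw [← hg] at hsel
    set i := Nat.count (fun t => isSelected g (2 ^ (n + 1)) (2 ^ r) t = true) t with hi
    have him : i * 2 ^ r ≤ 2 ^ (m + 1) :=
      (count_isSelected_mul_le (by positivity) (by positivity) ht).trans (count_arrivalNum_le _)
    have hlen_i : (natToStr i).length + r ≤ m + 2 := by
      have h3 := two_pow_length_le (natToStr i)
      rw [strToNat_natToStr] at h3
      have h4 : 2 ^ r ≤ 2 ^ (m + 1) := Nat.pow_le_pow_right (by norm_num) hrm
      refine (Nat.pow_le_pow_iff_right (a := 2) (by norm_num)).1 ?_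
      calc 2 ^ ((natToStr i).length + r) = 2 ^ (natToStr i).length * 2 ^ r := pow_add _ _ _
        _ ≤ (i + 1) * 2 ^ r := Nat.mul_le_mul_right _ h3
        _ = i * 2 ^ r + 2 ^ r := by ring
        _ ≤ 2 ^ (m + 1) + 2 ^ (m + 1) := Nat.add_le_add him h4
        _ = 2 ^ (m + 2) := by ring
    have hlen_iR : ((natToStr i).length : ℝ) + r ≤ m + 2 := by exact_mod_cast hlen_i
    have hlen_j : ((natToStr j).length : ℝ) ≤ r + 1 + logSucc n := by
      refine (length_natToStr_le j).trans ?_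
      have h3 : (r : ℝ) + 1 = Real.logb 2 ((2 : ℝ) ^ (r + 1)) := by
        rw [Real.logb_pow, Real.logb_self_eq_one (by norm_num)]
        push_cast
        ring
      rw [h3, logSucc, logSucc, ← Real.logb_mul (by positivity) (by positivity)]
      exact Real.logb_le_logb_of_le (by norm_num) (by positivity) (by exact_mod_cast hr4)
    have hselR : (CSet U A : ℝ) ≤ (natToStr i).length +
        2 * logSucc (Nat.pair r (Nat.pair n (Nat.pair m l))) + 2 * v.length + k₂ := by
      have h3 : (CSet U A : ℝ) ≤ (natToStr i).length +
          2 * (natToStr (Nat.pair r (Nat.pair n (Nat.pair m l)))).length + 2 * v.length + k₂ := by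
        exact_mod_cast hsel
      linarith [length_natToStr_le (Nat.pair r (Nat.pair n (Nat.pair m l)))]
    have hpair' := logSucc_pair_le r (Nat.pair n (Nat.pair m l))
    have hLr := (logSucc_mono hrm).trans (logSucc_succ_le m)
    -- Adding `hlen_iR` and `hlen_j` cancels `r`: the two indices together have at most `m + 3 +
    -- logSucc n` bits.
    linarith

theorem ceil_logb_card (A : Finset (List Bool)) :
    ⌈Real.logb 2 (A.card : ℝ)⌉ = (Nat.clog 2 A.card : ℤ) := by
  have h := Real.ceil_logb_natCast (b := 2) (r := (A.card : ℝ)) (Nat.cast_nonneg _)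
  rw [Int.clog_natCast] at h
  exact_mod_cast h

theorem theorem2 (U : List Bool → List Bool →. List Bool) (hU : IsReferenceMachine U)
    (𝒜 : Set (Finset (List Bool))) (h𝒜 : IsDistortionFamily 𝒜)
    (h2 : Property2 𝒜) (h3 : Property3 U 𝒜) :
    ∃ c : ℝ, ∀ (n : ℕ) (x : List Bool), x.length = n → ∀ B ∈ 𝒜, x ∈ B →
      ∃ A ∈ 𝒜, x ∈ A ∧
        ⌈Real.logb 2 (A.card : ℝ)⌉ = ⌈Real.logb 2 (B.card : ℝ)⌉ ∧
        (CSet U A : ℝ) ≤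
          (algInfo U x B : ℝ) +
            c * (Real.logb 2 (CSet U B : ℝ) + Real.logb 2 (n : ℝ)) + c := by
  obtain ⟨c', hc'⟩ := h3
  obtain ⟨k, hk⟩ := exists_small_complexity hU h𝒜 h2
  -- Replacing the two terms `logSucc` by logarithms costs `64 * 2 = 128`, and Property 3
  -- contributes `4 * |c'|`, both as a factor of `log n` and as a constant.
  refine ⟨4 * |c'| + k + 128, ?_⟩
  rintro n x rfl B hB hxB
  obtain ⟨A, hA, hxA, hcard, hAC⟩ := hk x B hB hxB
  refine ⟨A, hA, hxA, by rw [ceil_logb_card, ceil_logb_card, hcard], ?_⟩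
  have h4 := hc' x.length
  have h5 := logSucc_le (CSet U B)
  have h6 := logSucc_le x.length
  have h7 := logb_natCast_nonneg (CSet U B)
  have h8 := logb_natCast_nonneg x.length
  have h9 : (0 : ℝ) ≤ k := Nat.cast_nonneg _
  have h10 := abs_nonneg c'
  have h11 : c' * Real.logb 2 (x.length : ℝ) ≤ |c'| * Real.logb 2 (x.length : ℝ) :=
    mul_le_mul_of_nonneg_right (le_abs_self c') h8
  have h12 := le_abs_self c'
  have h13 := mul_nonneg h10 h7
  have h14 := mul_nonneg h9 (add_nonneg h7 h8)
  linarith
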